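/- Let $k$ be a field and let $H$ be an irreducible affine algebraic group scheme over $k$ (an affine group scheme of finite type over $k$ whose underlying space is irreducible), with coordinate Hopf algebra $k[H]$. Let $I_e\subseteq k[H]$ be the vanishing ideal of the identity element $e$, i.e. the kernel of the counit. Let $\mathrm{Dist}(H)$ be the algebra of all $k$-linear functionals on $k[H]$ that vanish on some power of $I_e$, with the convolution product $(uv)(f)=(u\otimes v)(\Delta_{k[H]}f)$ and unit element the evaluation at $e$. For $u\in\mathrm{Dist}(H)$ let $\Delta u\in\mathrm{Dist}(H)\otimes\mathrm{Dist}(H)$ be the unique element with $(\Delta u)(f\otimes g)=u(fg)$ for all $f,g\in k[H]$; this is the comultiplication of $\mathrm{Dist}(H)$. Let $\mathrm{Lie}(H)\subseteq\mathrm{Dist}(H)$ be the space of functionals that vanish on $1$ and on $I_e^2$. Let $A$ be a commutative $k$-algebra which is a unique factorisation domain, and suppose that $A$ is a $\mathrm{Dist}(H)$-algebra: $A$ is a $\mathrm{Dist}(H)$-module, extending its $k$-vector space structure, such that the multiplication $A\otimes_k A\to A$ is a morphism of $\mathrm{Dist}(H)$-modules, where $u\in\mathrm{Dist}(H)$ acts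 on $A\otimes_k A$ through $\Delta u$. A subspace $N$ of $A$ is called $\mathrm{Dist}(H)$-stable if $u\cdot x\in N$ for all $u\in\mathrm{Dist}(H)$ and $x\in N$, and $\mathrm{Lie}(H)$-stable if this holds for all $u\in\mathrm{Lie}(H)$ and $x\in N$. Then the multiplicative monoid $$M=\{a\in A\setminus\{0\} : Aa \text{ is } \mathrm{Dist}(H)\text{-stable}\}$$ has the unique factorisation property: every element of $M$ is, up to a unit of $M$, a product of irreducible elements of $M$, and the irreducible factors are unique up to order and up to units of $M$. Moreover: 1. If $\mathrm{char}\,k=0$, then the irreducible elements of $M$ are exactly the irreducible elements $a$ of $A$ such that $Aa$ is $\mathrm{Lie}(H)$-stable. 2. If $\mathrm{char}\,k=p>0$, then the irreducible elements of $M$ are, up to multiplication by units of $A$, exactly the elements $a^{p^s}$, where $a$ is an irreducible element of $A$, $s\ge0$, $Aa^{p^s}$ is $\mathrm{Dist}(H)$-stable, and $s$ is minimal with this property. That is, $b\in A$ is an irreducible element of $M$ if and only if $b=va^{p^s}$ for some unit $v$ of $A$ and some $a$ and $s$ as described. -/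

import Mathlib

open scoped TensorProduct
open CategoryTheory AlgebraicGeometry

universe u v

namespace GroupSchemeDist

/-! ### Distributions on an affine group scheme

In this section `R` is the coordinate ring `k[H]` of an affine group (or monoid) scheme `H`
over `k`: multiplication of `H` is the comultiplication of `R`, and the identity `e ∈ H(k)` is
the counit of `R`. -/

section Distributions

variable (k : Type*) (R : Type*) [Field k] [CommRing R] [Bialgebra k R]

/-- The vanishing ideal `I_e` of the identity element. -/
noncomputable def vanishingIdeal : Ideal R := RingHom.ker (Bialgebra.counitAlgHom k R)

variable {k R} in
theorem mem_vanishingIdeal {f : R} :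
    f ∈ vanishingIdeal k R ↔ Coalgebra.counit (R := k) f = 0 := by
  simp [vanishingIdeal, RingHom.mem_ker]

/-- `Δ(I_e) ⊆ I_e ⊗ R + R ⊗ I_e`. -/
theorem map_comul_vanishingIdeal_le :
    (vanishingIdeal k R).map (Bialgebra.comulAlgHom k R) ≤
      (vanishingIdeal k R).map (Algebra.TensorProduct.includeLeft (R := k) (S := k) (A := R)
          (B := R)) ⊔
      (vanishingIdeal k R).map (Algebra.TensorProduct.includeRight (R := k) (A := R)
          (B := R)) := by
  rw [Ideal.map_le_iff_le_comap]
  intro f hf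
  have hker := Algebra.TensorProduct.map_ker (Bialgebra.counitAlgHom k R)
    (Bialgebra.counitAlgHom k R)
    (fun c => ⟨algebraMap k R c, by simp⟩) (fun c => ⟨algebraMap k R c, by simp⟩)
  have : Coalgebra.comul (R := k) f ∈ RingHom.ker (Algebra.TensorProduct.map
      (Bialgebra.counitAlgHom k R) (Bialgebra.counitAlgHom k R)) := by
    rw [RingHom.mem_ker]
    have h1 : Algebra.TensorProduct.map (Bialgebra.counitAlgHom k R)
        (Bialgebra.counitAlgHom k R) (Coalgebra.comul (R := k) f) =
        LinearMap.lTensor k (Coalgebra.counit (R := k) (A := R))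
        ((Coalgebra.counit (R := k) (A := R)).rTensor R (Coalgebra.comul (R := k) f)) := by
      rw [← LinearMap.comp_apply, LinearMap.lTensor_comp_rTensor]
      rfl
    rw [h1, Coalgebra.rTensor_counit_comul, LinearMap.lTensor_tmul, mem_vanishingIdeal.1 hf,
      TensorProduct.tmul_zero]
  rw [hker] at this
  exact this

/-- The distributions of `H` with support in the identity, as a subalgebra of the convolution
algebra `k[H]^*`: the linear functionals on `R = k[H]` that vanish on some power of `I_e`. -/
noncomputable def distSubalgebra : Subalgebra k (WithConv (R →ₗ[k] k)) where
  carrier := {u | ∃ n : ℕ, ∀ f ∈ vanishingIdeal k R ^ (n + 1), u f = 0}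
  mul_mem' := by
    rintro u v ⟨n, hu⟩ ⟨m, hv⟩
    refine ⟨n + m + 1, fun f hf => ?_⟩
    have h1 : Coalgebra.comul (R := k) f ∈
        ((vanishingIdeal k R).map (Bialgebra.comulAlgHom k R)) ^ ((n + 1) + (m + 1)) := by
      rw [← Ideal.map_pow]
      have h := Ideal.mem_map_of_mem (Bialgebra.comulAlgHom k R) hf
      rw [show n + 1 + (m + 1) = n + m + 1 + 1 by ring]
      simpa using h
    have h2 := Ideal.sup_pow_add_le_pow_sup_pow
      (Ideal.pow_right_mono (map_comul_vanishingIdeal_le k R) _ h1)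
    rw [← Ideal.map_pow, ← Ideal.map_pow, Submodule.mem_sup] at h2
    obtain ⟨y, hy, z, hz, hyz⟩ := h2
    rw [LinearMap.convMul_apply, ← hyz, map_add, map_add]
    have hy0 : LinearMap.mul' k k (TensorProduct.map u.ofConv v.ofConv y) = 0 := by
      have hy' : y ∈ (Ideal.map (Algebra.TensorProduct.includeLeft (R := k) (S := k) (A := R)
          (B := R)) (vanishingIdeal k R ^ (n + 1))).restrictScalars k := hy
      rw [Ideal.map_includeLeft_eq] at hy'
      obtain ⟨w, rfl⟩ := hy'
      clear hy hyz
      induction w with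
      | zero => simp
      | add a b ha hb => simp only [map_add, ha, hb, add_zero]
      | tmul a b => simpa using Or.inl (hu a a.2)
    have hz0 : LinearMap.mul' k k (TensorProduct.map u.ofConv v.ofConv z) = 0 := by
      have hz' : z ∈ (Ideal.map (Algebra.TensorProduct.includeRight (R := k) (A := R)
          (B := R)) (vanishingIdeal k R ^ (m + 1))).restrictScalars k := hz
      rw [Ideal.map_includeRight_eq] at hz'
      obtain ⟨w, rfl⟩ := hz'
      clear hz hyz
      induction w with
      | zero => simp
      | add a b ha hb => simp only [map_add, ha, hb, add_zero]
      | tmul a b => simpa using Or.inr (hv b b.2)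
    rw [hy0, hz0, add_zero]
  add_mem' := by
    rintro u v ⟨n, hu⟩ ⟨m, hv⟩
    refine ⟨max n m, fun f hf => ?_⟩
    have h1 := hu f (Ideal.pow_le_pow_right (by omega) hf)
    have h2 := hv f (Ideal.pow_le_pow_right (by omega) hf)
    change u f + v f = 0
    rw [h1, h2, add_zero]
  algebraMap_mem' := fun c => ⟨0, fun f hf => by
    have : Coalgebra.counit (R := k) f = 0 := mem_vanishingIdeal.1 (by simpa using hf)
    simp [this]⟩

/-- The algebra `Dist(H)` of distributions of `H` with support in the identity. Its product is the
convolution product `(u * v)(f) = (u ⊗ v)(Δ f)`, its unit is the counit of `k[H]`, i.e. the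
evaluation at `e`. -/
def DistAlg : Type _ := distSubalgebra k R

noncomputable instance : Ring (DistAlg k R) := inferInstanceAs (Ring (distSubalgebra k R))

noncomputable instance : Algebra k (DistAlg k R) := inferInstanceAs (Algebra k (distSubalgebra k R))

noncomputable instance : AddCommGroup (DistAlg k R) := Ring.toAddCommGroup

/-- The Lie algebra `Lie(H) ⊆ Dist(H)`: the distributions that vanish on `1` and on `I_e ^ 2`
(the tangent space of `H` at the identity). -/
def LieDist : Submodule k (DistAlg k R) where
  carrier := {u | u.1 1 = 0 ∧ ∀ f ∈ vanishingIdeal k R ^ 2, u.1 f = 0}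
  add_mem' := by
    rintro u v ⟨hu, hu'⟩ ⟨hv, hv'⟩
    refine ⟨?_, fun f hf => ?_⟩
    · change u.1 1 + v.1 1 = 0
      rw [hu, hv, add_zero]
    · change u.1 f + v.1 f = 0
      rw [hu' f hf, hv' f hf, add_zero]
  zero_mem' := ⟨rfl, fun _ _ => rfl⟩
  smul_mem' := by
    rintro c u ⟨hu, hu'⟩
    refine ⟨?_, fun f hf => ?_⟩
    · change c * u.1 1 = 0
      rw [hu, mul_zero]
    · change c * u.1 f = 0
      rw [hu' f hf, mul_zero]

/-- The linear functional on `k[H]` underlying a distribution. -/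
def DistAlg.toDual : DistAlg k R →ₗ[k] Module.Dual k R where
  toFun u := u.1.ofConv
  map_add' _ _ := rfl
  map_smul' _ _ := rfl

theorem DistAlg.toDual_injective : Function.Injective (DistAlg.toDual k R) := fun _ _ h =>
  Subtype.ext (WithConv.ofConv_injective h)

/-- The pairing of `Dist(H) ⊗ Dist(H)` with `k[H] ⊗ k[H]`, given by
`(u ⊗ v)(f ⊗ g) = u(f) v(g)`. -/
noncomputable def DistAlg.pairing : DistAlg k R ⊗[k] DistAlg k R →ₗ[k] Module.Dual k (R ⊗[k] R) :=
  TensorProduct.dualDistrib k R R ∘ₗ TensorProduct.map (DistAlg.toDual k R) (DistAlg.toDual k R)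

variable {k R} in
@[simp]
theorem DistAlg.pairing_tmul (u v : DistAlg k R) (f g : R) :
    DistAlg.pairing k R (u ⊗ₜ v) (f ⊗ₜ g) = u.1 f * v.1 g := rfl

theorem DistAlg.pairing_injective : Function.Injective (DistAlg.pairing k R) := by
  classical
  rw [injective_iff_map_eq_zero]
  intro t ht
  let b := Module.Free.chooseBasis k (DistAlg k R)
  let e := TensorProduct.equivFinsuppOfBasisRight (M := DistAlg k R) b
  have hsum : t = (e t).sum fun i m => m ⊗ₜ[k] b i := by
    rw [← TensorProduct.equivFinsuppOfBasisRight_symm_apply]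
    exact (e.symm_apply_apply t).symm
  suffices e t = 0 by simpa using this
  ext1 i
  apply DistAlg.toDual_injective k R
  ext f
  have h0 : (e t).sum (fun i m => (DistAlg.toDual k R m f) • b i) = 0 := by
    apply DistAlg.toDual_injective k R
    ext g
    have := LinearMap.congr_fun ht (f ⊗ₜ g)
    rw [hsum, Finsupp.sum, map_sum, LinearMap.sum_apply] at this
    rw [Finsupp.sum, map_sum, LinearMap.sum_apply, map_zero, LinearMap.zero_apply]
    exact this
  have hli := b.linearIndependent
  have h1 := (linearIndependent_iff'.1 hli) (e t).support (fun i => DistAlg.toDual k R (e t i) f) h0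
  by_cases hi : i ∈ (e t).support
  · simpa using h1 i hi
  · rw [Finsupp.notMem_support_iff.1 hi]; rfl

theorem finite_quotient_vanishingIdeal_pow [Algebra.FiniteType k R] (n : ℕ) :
    Module.Finite k (R ⧸ vanishingIdeal k R ^ (n + 1)) := by
  have : IsNoetherianRing R := Algebra.FiniteType.isNoetherianRing k R
  let f : (R ⧸ vanishingIdeal k R ^ (n + 1)) →ₐ[k] k :=
    Ideal.Quotient.liftₐ _ (Bialgebra.counitAlgHom k R) fun a ha =>
      (RingHom.mem_ker).1 (Ideal.pow_le_self n.succ_ne_zero ha)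
  refine Module.finite_of_surjective_of_ker_le_nilradical f (fun c => ⟨algebraMap _ _ c, by simp⟩)
    ?_ (IsNoetherian.noetherian _)
  intro x hx
  obtain ⟨r, rfl⟩ := Ideal.Quotient.mk_surjective x
  have hr : r ∈ vanishingIdeal k R := by
    rw [mem_vanishingIdeal]; exact hx
  refine mem_nilradical.2 ⟨n + 1, ?_⟩
  rw [← map_pow, Ideal.Quotient.eq_zero_iff_mem]
  exact Ideal.pow_mem_pow hr _

variable {k R} in
theorem DistAlg.exists_pairing_eq [Algebra.FiniteType k R] (u : DistAlg k R) :
    ∃ t : DistAlg k R ⊗[k] DistAlg k R,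
      DistAlg.pairing k R t = DistAlg.toDual k R u ∘ₗ LinearMap.mul' k R := by
  classical
  obtain ⟨n, hn⟩ := u.2
  have := finite_quotient_vanishingIdeal_pow k R n
  let b := Module.Free.chooseBasis k (R ⧸ vanishingIdeal k R ^ (n + 1))
  choose r hr using fun i => Ideal.Quotient.mk_surjective (b i)
  let φ : Module.Free.ChooseBasisIndex k (R ⧸ vanishingIdeal k R ^ (n + 1)) → DistAlg k R := fun i =>
    ⟨WithConv.toConv (b.coord i ∘ₗ (Ideal.Quotient.mkₐ k _).toLinearMap), n, fun f hf => by
      change b.coord i (Ideal.Quotient.mk _ f) = 0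
      rw [Ideal.Quotient.eq_zero_iff_mem.2 hf, map_zero]⟩
  let ψ : Module.Free.ChooseBasisIndex k (R ⧸ vanishingIdeal k R ^ (n + 1)) → DistAlg k R := fun i =>
    ⟨WithConv.toConv (u.1.ofConv ∘ₗ LinearMap.mulLeft k (r i)), n, fun f hf =>
      hn _ (Ideal.mul_mem_left _ _ hf)⟩
  refine ⟨∑ i, φ i ⊗ₜ ψ i, ?_⟩
  ext f g
  have hfg : f - ∑ i, (b.coord i (Ideal.Quotient.mk _ f)) • r i ∈
      vanishingIdeal k R ^ (n + 1) := by
    rw [← Ideal.Quotient.eq_zero_iff_mem, map_sub, sub_eq_zero, map_sum]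
    conv_lhs => rw [← b.sum_repr (Ideal.Quotient.mk _ f)]
    refine Finset.sum_congr rfl fun i _ => ?_
    rw [← hr i]
    rfl
  have h := hn _ (Ideal.mul_mem_right g _ hfg)
  rw [sub_mul, Finset.sum_mul] at h
  replace h : u.1.ofConv (f * g) - u.1.ofConv
    (∑ i, (b.coord i (Ideal.Quotient.mk _ f) • r i) * g) = 0 := by rw [← map_sub]; exact h
  rw [sub_eq_zero, map_sum] at h
  simp only [TensorProduct.AlgebraTensorModule.curry_apply, TensorProduct.curry_apply,
    LinearMap.coe_restrictScalars, LinearMap.comp_apply, LinearMap.mul'_apply, map_sum,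
    LinearMap.sum_apply, DistAlg.pairing_tmul]
  refine Eq.trans ?_ h.symm
  refine Finset.sum_congr rfl fun i _ => ?_
  rw [smul_mul_assoc, map_smul]
  rfl

/-- The comultiplication of `Dist(H)`, induced by the diagonal embedding of `H`: `Δ u` is the
unique element of `Dist(H) ⊗ Dist(H)` with `(Δ u)(f ⊗ g) = u(f g)`, see `DistAlg.pairing_comul`. -/
noncomputable def DistAlg.comul [Algebra.FiniteType k R] :
    DistAlg k R →ₗ[k] DistAlg k R ⊗[k] DistAlg k R :=
  (LinearEquiv.ofInjective (DistAlg.pairing k R) (DistAlg.pairing_injective k R)).symm.toLinearMap ∘ₗ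
    LinearMap.codRestrict (LinearMap.range (DistAlg.pairing k R))
      (LinearMap.lcomp k k (LinearMap.mul' k R) ∘ₗ DistAlg.toDual k R)
      (fun u => DistAlg.exists_pairing_eq u)

variable {k R} in
theorem DistAlg.pairing_comul [Algebra.FiniteType k R] (u : DistAlg k R) (f g : R) :
    DistAlg.pairing k R (DistAlg.comul k R u) (f ⊗ₜ g) = u.1 (f * g) := by
  have h : DistAlg.pairing k R (DistAlg.comul k R u) = DistAlg.toDual k R u ∘ₗ LinearMap.mul' k R :=
    congrArg Subtype.val (LinearEquiv.apply_symm_apply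
      (LinearEquiv.ofInjective (DistAlg.pairing k R) (DistAlg.pairing_injective k R)) _)
  rw [h]
  rfl

end Distributions

/-! ### `Dist(H)`-algebras and stable ideals -/

section Algebras

variable (k : Type*) (R : Type*) [Field k] [CommRing R] [Bialgebra k R]

/-- The action of `Dist(H) ⊗ Dist(H)` on `A ⊗ A` for a `Dist(H)`-module `A`:
`(u ⊗ v) • (a ⊗ b) = (u • a) ⊗ (v • b)`. -/
noncomputable def tensorAction (A : Type*) [CommRing A] [Algebra k A] [Module (DistAlg k R) A]
    [IsScalarTower k (DistAlg k R) A] :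
    DistAlg k R ⊗[k] DistAlg k R →ₗ[k] Module.End k (A ⊗[k] A) :=
  TensorProduct.homTensorHomMap (.id k) A A A A ∘ₗ TensorProduct.map
    (Algebra.lsmul k k A).toLinearMap (Algebra.lsmul k k A).toLinearMap

/-- A commutative `k`-algebra `A` with a `Dist(H)`-module structure (extending its `k`-vector
space structure) is a `Dist(H)`-algebra if the multiplication `A ⊗ A → A` is a morphism of
`Dist(H)`-modules, where `u ∈ Dist(H)` acts on `A ⊗ A` through `Δ u`. -/
class IsDistAlgebra [Algebra.FiniteType k R] (A : Type*) [CommRing A] [Algebra k A]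
    [Module (DistAlg k R) A] [IsScalarTower k (DistAlg k R) A] : Prop where
  smul_mul' : ∀ (u : DistAlg k R) (x : A ⊗[k] A),
    u • LinearMap.mul' k A x = LinearMap.mul' k A (tensorAction k R A (DistAlg.comul k R u) x)

variable {A : Type*} [CommRing A]

/-- The ideal `I` is `Dist(H)`-stable. -/
def IsDistStable [Module (DistAlg k R) A] (I : Ideal A) : Prop :=
  ∀ u : DistAlg k R, ∀ x ∈ I, u • x ∈ I

/-- The ideal `I` is `Lie(H)`-stable. -/
def IsLieStable [Module (DistAlg k R) A] (I : Ideal A) : Prop :=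
  ∀ u ∈ LieDist k R, ∀ x ∈ I, u • x ∈ I

variable {k R} in
theorem IsDistStable.mul [Algebra k A] [Module (DistAlg k R) A] [IsScalarTower k (DistAlg k R) A]
    [Algebra.FiniteType k R] [IsDistAlgebra k R A] {I J : Ideal A}
    (hI : IsDistStable k R I) (hJ : IsDistStable k R J) : IsDistStable k R (I * J) := by
  intro u x hx
  induction hx using Submodule.mul_induction_on' with
  | mem_mul_mem a ha b hb =>
    have h := IsDistAlgebra.smul_mul' (k := k) (R := R) u (a ⊗ₜ[k] b)
    rw [LinearMap.mul'_apply] at h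
    rw [h]
    generalize DistAlg.comul k R u = t
    induction t with
    | zero => simp
    | add s t hs ht =>
      rw [map_add, LinearMap.add_apply, map_add]
      exact add_mem hs ht
    | tmul v w => exact Ideal.mul_mem_mul (hI v a ha) (hJ w b hb)
  | add a _ b _ ha hb =>
    rw [smul_add]
    exact add_mem ha hb

variable (A) in
/-- The monoid of nonzero elements `a` of the domain `A` such that the principal ideal `Aa` is
`Dist(H)`-stable. -/
def distStableMonoid [IsDomain A] [Algebra k A] [Module (DistAlg k R) A]
    [IsScalarTower k (DistAlg k R) A] [Algebra.FiniteType k R] [IsDistAlgebra k R A] :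
    Submonoid A where
  carrier := {a | a ≠ 0 ∧ IsDistStable k R (Ideal.span {a})}
  one_mem' := ⟨one_ne_zero, fun u x _ => by simp⟩
  mul_mem' := by
    rintro a b ⟨ha, ha'⟩ ⟨hb, hb'⟩
    refine ⟨mul_ne_zero ha hb, ?_⟩
    rw [← Ideal.span_singleton_mul_span_singleton]
    exact ha'.mul hb'

end Algebras

/-- The unique factorisation property for a commutative (cancellative) monoid `M`: every element
is, up to a unit, a product of irreducible elements, and the irreducible factors are unique up to
order and units. -/
def HasUniqueFactorization (M : Type*) [CommMonoid M] : Prop :=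
  (∀ a : M, ∃ s : Multiset M, (∀ x ∈ s, Irreducible x) ∧ Associated s.prod a) ∧
  ∀ s t : Multiset M, (∀ x ∈ s, Irreducible x) → (∀ x ∈ t, Irreducible x) →
    Associated s.prod t.prod → Multiset.Rel Associated s t

/-! ### Affine group schemes -/

section GroupSchemes

variable (k : Type u) [Field k] (H : Scheme.{u}) [H.Over (Spec (.of k))] [IsAffine H]

/-- The coordinate ring `k[H]` of an affine scheme `H` over `k`. -/
def CoordRing : Type u := Γ(H, ⊤)

noncomputable instance : CommRing (CoordRing H) := inferInstanceAs (CommRing Γ(H, ⊤))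

/-- Mathlib's Hopf algebra structure on the global sections of an affine group scheme, obtained from
the anti-equivalence `Spec` between commutative Hopf algebras and affine group schemes. -/
noncomputable abbrev hopfAlgebraGlobalSections (S : CommRingCat.{u}) (G : Scheme.{u})
    [G.Over (Spec S)] [IsAffine G] [GrpObj (G.asOver (Spec S))] : HopfAlgebra S Γ(G, ⊤) :=
  inferInstance

theorem finiteType_algebraMap_globalSections (S : CommRingCat.{u}) (G : Scheme.{u})
    [G.Over (Spec S)] [IsAffine G] [GrpObj (G.asOver (Spec S))]
    [LocallyOfFiniteType (G ↘ Spec S)] :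
    (@algebraMap S Γ(G, ⊤) _ _
      (hopfAlgebraGlobalSections S G).toBialgebra.toAlgebra).FiniteType := by
  change (algebraMap S Γ(G, ⊤)).FiniteType
  rw [algebraMap_presheafObj]
  have h : LocallyOfFiniteType (G.isoSpec.inv ≫ G ↘ Spec S) := inferInstance
  rw [← Spec.fullyFaithful.map_preimage (G.isoSpec.inv ≫ G ↘ Spec S)] at h
  exact (HasRingHomProperty.Spec_iff (P := @LocallyOfFiniteType)).1 h

/-- The Hopf algebra structure on the coordinate ring of an affine group scheme over `k`. -/
noncomputable instance [GrpObj (H.asOver (Spec (.of k)))] : HopfAlgebra k (CoordRing H) :=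
  hopfAlgebraGlobalSections (.of k) H

/-- The coordinate ring of an affine group scheme of finite type over `k` is a finitely generated
`k`-algebra. -/
instance [GrpObj (H.asOver (Spec (.of k)))] [LocallyOfFiniteType (H ↘ Spec (.of k))] :
    Algebra.FiniteType k (CoordRing H) := by
  rw [← RingHom.finiteType_algebraMap]
  exact finiteType_algebraMap_globalSections (.of k) H

end GroupSchemes

end GroupSchemeDist

open GroupSchemeDist

/-! Filter `Dist(H)` by the spaces F_n of functionals vanishing on I_e^n. For u in F_{n+1}, Δu
equals u ⊗ 1 + 1 ⊗ u up to a scalar multiple of 1 ⊗ 1 and a term in F_n ⊗ F_n (`exists_comul_eq`).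
Hence u acts on a product as a derivation modulo terms of lower order, and induction on n shows two
things. If xy generates a stable ideal and x, y are coprime, then so does x
(`IsDistStable.left_of_mul`). If a^m does and m is nonzero in k, then so does a
(`IsDistStable.of_pow`).

Let q be the exponential characteristic of k (1 or p). Every element of M is then a product of
stable prime powers, and the stable powers of a prime a, if any besides 1, are up to units the
powers of a^{q^s} with s minimal (`pow_dvd_of_isDistStable_pow`). So up to units M is free on these
elements, which are its irreducibles.

In characteristic 0 one has q = 1, and Lie-stability suffices because `Lie(H)` generates `Dist(H)`.
This follows by comparing two expressions for the product of the two legs of Δu: it is 2u modulo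
products of lower order terms, but also u composed with the comorphism of h ↦ h², which is 2^n on
I_e^n / I_e^{n+1}. -/

namespace GroupSchemeDist

/-! ### The order filtration of `Dist(H)` and generation by `Lie(H)` in characteristic 0 -/

section Filtration

variable (k : Type*) (R : Type*) [Field k] [CommRing R] [Bialgebra k R]

/-- The distributions that vanish on `I_e ^ n`. -/
def distFiltration (n : ℕ) : Submodule k (DistAlg k R) where
  carrier := {u | ∀ f ∈ vanishingIdeal k R ^ n, DistAlg.toDual k R u f = 0}
  add_mem' := by
    intro u v hu hv f hf
    rw [map_add, LinearMap.add_apply, hu f hf, hv f hf, add_zero]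
  zero_mem' := fun f _ => by rw [map_zero, LinearMap.zero_apply]
  smul_mem' := by
    intro c u hu f hf
    rw [map_smul, LinearMap.smul_apply, hu f hf, smul_zero]

variable {k R}

theorem mem_distFiltration {n : ℕ} {u : DistAlg k R} :
    u ∈ distFiltration k R n ↔ ∀ f ∈ vanishingIdeal k R ^ n, DistAlg.toDual k R u f = 0 :=
  Iff.rfl

theorem distFiltration_mono : Monotone (distFiltration k R) := fun _ _ h _ hu f hf =>
  hu f (Ideal.pow_le_pow_right h hf)

theorem exists_mem_distFiltration (u : DistAlg k R) : ∃ n, u ∈ distFiltration k R n := by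
  obtain ⟨n, hn⟩ := u.2
  exact ⟨n + 1, hn⟩

theorem eq_zero_of_mem_distFiltration_zero {u : DistAlg k R} (hu : u ∈ distFiltration k R 0) :
    u = 0 := by
  apply DistAlg.toDual_injective k R
  ext f
  rw [map_zero, LinearMap.zero_apply]
  exact hu f (by simp)

theorem toDual_one (f : R) : DistAlg.toDual k R 1 f = Coalgebra.counit (R := k) f := rfl

theorem pairing_tmul_toDual (u v : DistAlg k R) (f g : R) :
    DistAlg.pairing k R (u ⊗ₜ v) (f ⊗ₜ g) =
      DistAlg.toDual k R u f * DistAlg.toDual k R v g := rfl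

theorem sub_counit_mem_vanishingIdeal (f : R) :
    f - algebraMap k R (Coalgebra.counit (R := k) f) ∈ vanishingIdeal k R := by
  simp [mem_vanishingIdeal]

/-- A bilinear form on `k[H]` that vanishes on `I_e ^ n` in both arguments comes from a tensor in
distributions that vanish on `I_e ^ n`. -/
theorem exists_pairing_eq_of_vanishing [Algebra.FiniteType k R] (n : ℕ)
    (B : R →ₗ[k] R →ₗ[k] k) (hl : ∀ f ∈ vanishingIdeal k R ^ n, ∀ g, B f g = 0)
    (hr : ∀ f, ∀ g ∈ vanishingIdeal k R ^ n, B f g = 0) :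
    ∃ t ∈ LinearMap.range (TensorProduct.map (distFiltration k R n).subtype
        (distFiltration k R n).subtype),
      ∀ f g, DistAlg.pairing k R t (f ⊗ₜ g) = B f g := by
  obtain _ | n := n
  · refine ⟨0, zero_mem _, fun f g => ?_⟩
    rw [hl f (by simp), map_zero, LinearMap.zero_apply]
  have := finite_quotient_vanishingIdeal_pow k R n
  -- For a basis b_i of this finite-dimensional quotient with lifts r_i, the tensor is the sum of
  -- b_i^* ⊗ B(r_i, ·).
  let b := Module.Free.chooseBasis k (R ⧸ vanishingIdeal k R ^ (n + 1))
  choose r hb using fun i => Ideal.Quotient.mk_surjective (b i)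
  let φ : Module.Free.ChooseBasisIndex k (R ⧸ vanishingIdeal k R ^ (n + 1)) →
      distFiltration k R (n + 1) := fun i =>
    ⟨⟨WithConv.toConv (b.coord i ∘ₗ (Ideal.Quotient.mkₐ k _).toLinearMap), n, fun f hf => by
      change b.coord i (Ideal.Quotient.mk _ f) = 0
      rw [Ideal.Quotient.eq_zero_iff_mem.2 hf, map_zero]⟩, fun f hf => by
      change b.coord i (Ideal.Quotient.mk _ f) = 0
      rw [Ideal.Quotient.eq_zero_iff_mem.2 hf, map_zero]⟩
  let ψ : Module.Free.ChooseBasisIndex k (R ⧸ vanishingIdeal k R ^ (n + 1)) →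
      distFiltration k R (n + 1) := fun i =>
    ⟨⟨WithConv.toConv (B (r i)), n, fun f hf => hr _ f hf⟩, fun f hf => hr _ f hf⟩
  refine ⟨_, ⟨∑ i, φ i ⊗ₜ ψ i, rfl⟩, fun f g => ?_⟩
  have hfg : f - ∑ i, (b.coord i (Ideal.Quotient.mk _ f)) • r i ∈
      vanishingIdeal k R ^ (n + 1) := by
    rw [← Ideal.Quotient.eq_zero_iff_mem, map_sub, sub_eq_zero, map_sum]
    conv_lhs => rw [← b.sum_repr (Ideal.Quotient.mk _ f)]
    refine Finset.sum_congr rfl fun i _ => ?_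
    rw [← hb i]
    rfl
  have h := hl _ hfg g
  rw [map_sub, LinearMap.sub_apply, sub_eq_zero, map_sum, LinearMap.sum_apply] at h
  rw [h, map_sum, map_sum, LinearMap.sum_apply]
  refine Finset.sum_congr rfl fun i _ => ?_
  rw [map_smul, LinearMap.smul_apply]
  rfl

/-- Up to lower order terms, distributions are primitive. -/
theorem exists_comul_eq [Algebra.FiniteType k R] {n : ℕ} {u : DistAlg k R}
    (hu : u ∈ distFiltration k R (n + 1)) :
    ∃ t ∈ LinearMap.range (TensorProduct.map (distFiltration k R n).subtype
        (distFiltration k R n).subtype),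
      DistAlg.comul k R u =
        u ⊗ₜ 1 + 1 ⊗ₜ u - DistAlg.toDual k R u 1 • ((1 : DistAlg k R) ⊗ₜ[k] (1 : DistAlg k R)) +
          t := by
  -- π projects onto I_e along the constants. The form u(πf · πg) is the part of u(fg) left after
  -- removing the terms with a constant factor. If f lies in I_e^n, then πf · πg lies in I_e^{n+1},
  -- where u vanishes.
  let π : R →ₗ[k] R := LinearMap.id -
    (Algebra.linearMap k R) ∘ₗ (Coalgebra.counit (R := k) (A := R))
  have hπ (f : R) : π f ∈ vanishingIdeal k R := sub_counit_mem_vanishingIdeal f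
  have hπ' {f : R} (hf : f ∈ vanishingIdeal k R) : π f = f := by
    simp [π, mem_vanishingIdeal.1 hf]
  let B : R →ₗ[k] R →ₗ[k] k :=
    ((LinearMap.mul k R).compl₁₂ π π).compr₂ (DistAlg.toDual k R u)
  have hB (f g : R) : B f g = DistAlg.toDual k R u (π f * π g) := rfl
  have hBl : ∀ f ∈ vanishingIdeal k R ^ n, ∀ g, B f g = 0 := by
    intro f hf g
    obtain _ | n := n
    · rw [hB]
      exact hu _ (by rw [zero_add, pow_one]; exact Ideal.mul_mem_left _ _ (hπ g))
    · rw [hB, hπ' (Ideal.pow_le_self n.succ_ne_zero hf)]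
      exact hu _ (by rw [pow_succ _ (n + 1)]; exact Ideal.mul_mem_mul hf (hπ g))
  have hBr : ∀ f, ∀ g ∈ vanishingIdeal k R ^ n, B f g = 0 := by
    intro f g hg
    rw [hB, mul_comm, ← hB, hBl g hg]
  obtain ⟨t, ht, htB⟩ := exists_pairing_eq_of_vanishing n B hBl hBr
  refine ⟨t, ht, ?_⟩
  apply DistAlg.pairing_injective k R
  ext f g
  have h1 : DistAlg.pairing k R (DistAlg.comul k R u) (f ⊗ₜ g) =
      DistAlg.toDual k R u (f * g) := DistAlg.pairing_comul u f g
  change DistAlg.pairing k R (DistAlg.comul k R u) (f ⊗ₜ g) = DistAlg.pairing k R _ (f ⊗ₜ g)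
  rw [h1, map_add, LinearMap.add_apply, htB, hB, map_sub, map_add, map_smul, LinearMap.sub_apply,
    LinearMap.add_apply, LinearMap.smul_apply, pairing_tmul_toDual, pairing_tmul_toDual,
    pairing_tmul_toDual, toDual_one, toDual_one]
  have h2 : f * g = π f * π g + (Coalgebra.counit (R := k) g) • f +
      (Coalgebra.counit (R := k) f) • g -
      (Coalgebra.counit (R := k) f * Coalgebra.counit (R := k) g) • 1 := by
    simp only [π, LinearMap.sub_apply, LinearMap.id_apply, LinearMap.comp_apply,
      Algebra.linearMap_apply, Algebra.smul_def, map_mul]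
    ring
  conv_lhs => rw [h2]
  simp only [map_add, map_sub, map_smul, smul_eq_mul]
  ring

theorem toDual_mul' (t : DistAlg k R ⊗[k] DistAlg k R) (f : R) :
    DistAlg.toDual k R (LinearMap.mul' k (DistAlg k R) t) f =
      DistAlg.pairing k R t (Coalgebra.comul (R := k) f) := by
  induction t with
  | zero => simp
  | add s t hs ht => simp only [map_add, LinearMap.add_apply, hs, ht]
  | tmul u v =>
    change (u.1 * v.1) f = _
    rw [LinearMap.convMul_apply]
    generalize (Coalgebra.comul (R := k) f) = w
    induction w with
    | zero => simp
    | add s t hs ht => simp only [map_add, hs, ht]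
    | tmul f g => rfl

variable (k R) in
/-- The comorphism of the squaring map `h ↦ h * h` of `H`. -/
noncomputable def squareComorphism : R →ₐ[k] R :=
  (Algebra.TensorProduct.lmul' k (S := R)).comp (Bialgebra.comulAlgHom k R)

/-- Product and coproduct of `Dist(H)` are dual to coproduct and product of k[H], so their composite
is dual to the squaring comorphism. -/
theorem toDual_mul'_comul [Algebra.FiniteType k R] (u : DistAlg k R) (f : R) :
    DistAlg.toDual k R (LinearMap.mul' k (DistAlg k R) (DistAlg.comul k R u)) f =
      DistAlg.toDual k R u (squareComorphism k R f) := by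
  rw [toDual_mul']
  change _ = DistAlg.toDual k R u (LinearMap.mul' k R (Coalgebra.comul (R := k) f))
  generalize (Coalgebra.comul (R := k) f) = w
  induction w with
  | zero => simp
  | add s t hs ht => simp only [map_add, hs, ht]
  | tmul f g => exact DistAlg.pairing_comul u f g

/-- The differential of h ↦ h² at e is multiplication by 2. -/
theorem squareComorphism_sub_mem {f : R} (hf : f ∈ vanishingIdeal k R) :
    squareComorphism k R f - 2 * f ∈ vanishingIdeal k R ^ 2 := by
  -- On w = f ⊗ g, with ε the counit, this expression is (f - ε(f))(g - ε(g)). For w = Δf the counit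
  -- axioms turn each of the last two terms into f.
  have key (w : R ⊗[k] R) :
      LinearMap.mul' k R w -
        algebraMap k R (LinearMap.mul' k k (TensorProduct.map Coalgebra.counit
          Coalgebra.counit w)) * (-1) -
        TensorProduct.lid k R ((Coalgebra.counit (R := k) (A := R)).rTensor R w) -
        TensorProduct.rid k R ((Coalgebra.counit (R := k) (A := R)).lTensor R w) ∈
        vanishingIdeal k R ^ 2 := by
    induction w with
    | zero => simp
    | add s t hs ht =>
      simp only [map_add]
      convert add_mem hs ht using 1
      ring
    | tmul f g =>
      have := Ideal.mul_mem_mul (sub_counit_mem_vanishingIdeal (k := k) f)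
        (sub_counit_mem_vanishingIdeal (k := k) g)
      rw [← pow_two] at this
      convert this using 1
      simp [Algebra.smul_def]
      ring
  have h := key (Coalgebra.comul (R := k) f)
  have h0 : LinearMap.mul' k k (TensorProduct.map Coalgebra.counit
          Coalgebra.counit (Coalgebra.comul (R := k) f)) = 0 := by
    rw [← LinearMap.lTensor_comp_rTensor, LinearMap.comp_apply, Coalgebra.rTensor_counit_comul,
      LinearMap.lTensor_tmul, mem_vanishingIdeal.1 hf, TensorProduct.tmul_zero, map_zero]
  rw [h0, Coalgebra.rTensor_counit_comul, Coalgebra.lTensor_counit_comul] at h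
  convert h using 1
  simp only [map_zero, zero_mul, sub_zero, TensorProduct.lid_tmul, TensorProduct.rid_tmul, one_smul]
  rw [two_mul, sub_sub]
  rfl

/-- Multiplicativity carries the factor 2 on I_e / I_e² to 2^n on I_e^n / I_e^{n+1}; degree 0 says
that squaring fixes e. -/
theorem squareComorphism_sub_pow_mem (n : ℕ) {f : R} (hf : f ∈ vanishingIdeal k R ^ n) :
    squareComorphism k R f - 2 ^ n * f ∈ vanishingIdeal k R ^ (n + 1) := by
  induction n generalizing f with
  | zero =>
    have h (f : R) : Coalgebra.counit (R := k) (squareComorphism k R f) =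
        Coalgebra.counit (R := k) f := by
      have h1 := sub_counit_mem_vanishingIdeal (k := k) f
      have h2 := mem_vanishingIdeal.1 (Ideal.pow_le_self two_ne_zero (squareComorphism_sub_mem h1))
      simpa [sub_eq_zero] using h2
    rw [zero_add, pow_one, pow_zero, one_mul, mem_vanishingIdeal, map_sub, h, sub_self]
  | succ n ih =>
    rw [pow_succ] at hf
    induction hf using Submodule.mul_induction_on' with
    | mem_mul_mem a ha b hb =>
      have h1 := ih ha
      have h2 := squareComorphism_sub_mem hb
      have e : squareComorphism k R (a * b) - 2 ^ (n + 1) * (a * b) =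
          (squareComorphism k R a - 2 ^ n * a) * (2 * b) +
          (squareComorphism k R a - 2 ^ n * a) * (squareComorphism k R b - 2 * b) +
          2 ^ n * (a * (squareComorphism k R b - 2 * b)) := by
        rw [map_mul]
        ring
      rw [e]
      refine add_mem (add_mem ?_ ?_) ?_
      · rw [pow_succ _ (n + 1)]
        exact Ideal.mul_mem_mul h1 (Ideal.mul_mem_left _ _ hb)
      · rw [pow_succ _ (n + 1)]
        exact Ideal.mul_mem_mul h1 (Ideal.pow_le_self two_ne_zero h2)
      · refine Ideal.mul_mem_left _ _ ?_
        rw [add_assoc, pow_add]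
        exact Ideal.mul_mem_mul ha h2
    | add a _ b _ ha hb =>
      convert add_mem ha hb using 1
      rw [map_add]
      ring

/-- In characteristic zero, the algebra `Dist(H)` is generated by `Lie(H)`. -/
theorem adjoin_lieDist_eq_top [CharZero k] [Algebra.FiniteType k R] :
    Algebra.adjoin k (LieDist k R : Set (DistAlg k R)) = ⊤ := by
  set S := Algebra.adjoin k (LieDist k R : Set (DistAlg k R))
  -- The induction starts at F_2, which is the scalars plus `Lie(H)`.
  suffices h : ∀ n, distFiltration k R (n + 2) ≤ Subalgebra.toSubmodule S by
    refine eq_top_iff.2 fun u _ => ?_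
    obtain ⟨n, hn⟩ := exists_mem_distFiltration u
    exact h n (distFiltration_mono (by omega) hn)
  intro n
  induction n with
  | zero =>
    intro u hu
    have h : u - DistAlg.toDual k R u 1 • 1 ∈ LieDist k R := by
      refine ⟨?_, fun f hf => ?_⟩
      · change DistAlg.toDual k R (u - DistAlg.toDual k R u 1 • 1) 1 = 0
        rw [map_sub, map_smul, LinearMap.sub_apply, LinearMap.smul_apply, toDual_one]
        simp
      · change DistAlg.toDual k R (u - DistAlg.toDual k R u 1 • 1) f = 0
        rw [map_sub, map_smul, LinearMap.sub_apply, LinearMap.smul_apply, toDual_one, hu f hf,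
          mem_vanishingIdeal.1 (Ideal.pow_le_self two_ne_zero hf)]
        simp
    have h' := S.add_mem (Algebra.subset_adjoin h) (S.smul_mem S.one_mem (DistAlg.toDual k R u 1))
    rwa [sub_add_cancel] at h'
  | succ n ih =>
    intro u hu
    have h1 : LinearMap.mul' k (DistAlg k R) (DistAlg.comul k R u) - (2 ^ (n + 2) : k) • u ∈
        distFiltration k R (n + 2) := by
      intro f hf
      rw [map_sub, map_smul, LinearMap.sub_apply, LinearMap.smul_apply, toDual_mul'_comul,
        ← map_smul, ← map_sub]
      convert hu _ (squareComorphism_sub_pow_mem (n + 2) hf) using 3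
      rw [Algebra.smul_def, map_pow, map_ofNat]
    have h2 : ∀ t, LinearMap.mul' k (DistAlg k R) (TensorProduct.map
        (distFiltration k R (n + 2)).subtype (distFiltration k R (n + 2)).subtype t) ∈ S := by
      intro t
      induction t with
      | zero => simp
      | add s t hs ht =>
        rw [map_add, map_add]
        exact S.add_mem hs ht
      | tmul v w => exact S.mul_mem (ih v.2) (ih w.2)
    obtain ⟨_, ⟨t, rfl⟩, ht⟩ := exists_comul_eq hu
    have h3 := S.sub_mem (S.sub_mem (ih h1) (h2 t))
      (S.neg_mem (S.smul_mem S.one_mem (DistAlg.toDual k R u 1)))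
    rw [ht] at h3
    simp only [map_add, map_sub, map_smul, LinearMap.mul'_apply, mul_one, one_mul] at h3
    -- The two expressions for the product of the legs of Δu are subtracted. The coefficient is
    -- nonzero because the exponent is at least 2 and the characteristic is 0.
    have h4 : ((2 : k) - 2 ^ (n + 2)) • u ∈ S := by
      convert h3 using 1
      rw [sub_smul, two_smul]
      abel
    have hne : ((2 : k) - 2 ^ (n + 2)) ≠ 0 := by
      rw [sub_ne_zero]
      have : (2 : ℕ) ≠ 2 ^ (n + 2) := by
        rw [pow_add]
        have := Nat.one_le_two_pow (n := n)
        omega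
      exact_mod_cast this
    have h5 := S.smul_mem h4 ((2 : k) - 2 ^ (n + 2))⁻¹
    rwa [inv_smul_smul₀ hne] at h5

end Filtration

/-! ### Stable principal ideals: coprime factors and roots -/

section StableIdeals

variable {k : Type*} {R : Type*} [Field k] [CommRing R] [Bialgebra k R]
  {A : Type*} [CommRing A] [Module (DistAlg k R) A]

theorem isDistStable_span_of_associated {a b : A} (h : Associated a b)
    (ha : IsDistStable k R (Ideal.span {a})) : IsDistStable k R (Ideal.span {b}) := by
  rwa [le_antisymm (Ideal.span_singleton_le_span_singleton.2 h.symm.dvd)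
    (Ideal.span_singleton_le_span_singleton.2 h.dvd)] at ha

variable (k R) in
/-- The powers `a ^ q ^ s` of an irreducible element `a`, where `s` is minimal such that `a ^ q ^ s`
generates a `Dist(H)`-stable ideal. -/
def IsMinimalStablePower (q : ℕ) (b : A) : Prop :=
  ∃ (a : A) (s : ℕ), Irreducible a ∧
    IsLeast {t : ℕ | IsDistStable k R (Ideal.span {a ^ q ^ t})} s ∧ Associated (a ^ q ^ s) b

/-- For q = 1 every a^{q^t} is a, so the minimal exponent is 0. This is the characteristic 0 case.
-/
theorem isMinimalStablePower_one_iff {b : A} :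
    IsMinimalStablePower k R 1 b ↔ Irreducible b ∧ IsDistStable k R (Ideal.span {b}) := by
  constructor
  · rintro ⟨a, s, ha, hs, h⟩
    have h1 := hs.1
    simp only [one_pow, pow_one, Set.mem_ofPred_eq] at h h1
    exact ⟨h.irreducible ha, isDistStable_span_of_associated h h1⟩
  · rintro ⟨hb, h⟩
    exact ⟨b, 0, hb, ⟨by simpa using h, fun _ _ => Nat.zero_le _⟩, by simp⟩

variable [Algebra k A] [IsScalarTower k (DistAlg k R) A]

theorem tensorAction_tmul (u v : DistAlg k R) (x y : A) :
    tensorAction k R A (u ⊗ₜ v) (x ⊗ₜ y) = (u • x) ⊗ₜ (v • y) := rfl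

variable [Algebra.FiniteType k R]

theorem isDistStable_iff_isLieStable [CharZero k] {I : Ideal A} :
    IsDistStable k R I ↔ IsLieStable k R I := by
  refine ⟨fun h u _ => h u, fun h u => ?_⟩
  have hu : u ∈ Algebra.adjoin k (LieDist k R : Set (DistAlg k R)) := by
    rw [adjoin_lieDist_eq_top]
    trivial
  induction hu using Algebra.adjoin_induction with
  | mem u hu => exact h u hu
  | algebraMap c =>
    intro x hx
    rw [algebraMap_smul, Algebra.smul_def]
    exact I.mul_mem_left _ hx
  | add u v _ _ hu hv =>
    intro x hx
    rw [add_smul]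
    exact add_mem (hu x hx) (hv x hx)
  | mul u v _ _ hu hv =>
    intro x hx
    rw [mul_smul]
    exact hu _ (hv x hx)

variable [IsDistAlgebra k R A]

theorem smul_mul_eq (u : DistAlg k R) (x y : A) :
    u • (x * y) = LinearMap.mul' k A (tensorAction k R A (DistAlg.comul k R u) (x ⊗ₜ y)) := by
  rw [← IsDistAlgebra.smul_mul', LinearMap.mul'_apply]

/-- Distributions act as derivations, up to lower order terms. -/
theorem smul_mul_sub_mem {n : ℕ} {u : DistAlg k R} (hu : u ∈ distFiltration k R (n + 1))
    {J : Ideal A} {x y : A} (hxy : x * y ∈ J)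
    (hJ : ∀ v ∈ distFiltration k R n, ∀ w ∈ distFiltration k R n, (v • x) * (w • y) ∈ J) :
    u • (x * y) - (u • x * y + x * u • y) ∈ J := by
  have h : ∀ t, LinearMap.mul' k A (tensorAction k R A (TensorProduct.map
        (distFiltration k R n).subtype (distFiltration k R n).subtype t) (x ⊗ₜ y)) ∈ J := by
    intro t
    induction t with
    | zero => simp
    | add s t hs ht =>
      rw [map_add, map_add, LinearMap.add_apply, map_add]
      exact add_mem hs ht
    | tmul v w => exact hJ v v.2 w w.2
  obtain ⟨_, ⟨t, rfl⟩, ht⟩ := exists_comul_eq hu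
  rw [smul_mul_eq, ht]
  simp only [map_add, map_sub, map_smul, LinearMap.add_apply, LinearMap.sub_apply,
    LinearMap.smul_apply, tensorAction_tmul, LinearMap.mul'_apply, one_smul]
  rw [Algebra.smul_def]
  have e := sub_mem (h t) (J.mul_mem_left (algebraMap k A (DistAlg.toDual k R u 1)) hxy)
  convert e using 1
  ring

/-- Testing the generator suffices, as u(ay) is a sum of products v(a)w(y). -/
theorem isDistStable_span_singleton {a : A} :
    IsDistStable k R (Ideal.span {a}) ↔ ∀ u : DistAlg k R, a ∣ u • a := by
  refine ⟨fun h u => Ideal.mem_span_singleton.1 (h u a (Ideal.mem_span_singleton_self a)),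
    fun h u x hx => ?_⟩
  obtain ⟨y, rfl⟩ := Ideal.mem_span_singleton.1 hx
  rw [smul_mul_eq]
  generalize DistAlg.comul k R u = t
  induction t with
  | zero => simp
  | add s t hs ht =>
    rw [map_add, LinearMap.add_apply, map_add]
    exact add_mem hs ht
  | tmul v w => exact Ideal.mul_mem_right _ _ (Ideal.mem_span_singleton.2 (h v))

theorem isDistStable_iff_forall_distFiltration {a : A} :
    IsDistStable k R (Ideal.span {a}) ↔ ∀ n, ∀ u ∈ distFiltration k R n, a ∣ u • a := by
  rw [isDistStable_span_singleton]
  refine ⟨fun h n u _ => h u, fun h u => ?_⟩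
  obtain ⟨n, hn⟩ := exists_mem_distFiltration u
  exact h n u hn

/-- A version of `IsDistStable.mul` truncated at order n, for use inside inductions on the order. -/
theorem dvd_smul_mul {n : ℕ} {x y : A} (hx : ∀ u ∈ distFiltration k R n, x ∣ u • x)
    (hy : ∀ u ∈ distFiltration k R n, y ∣ u • y) {u : DistAlg k R}
    (hu : u ∈ distFiltration k R n) : x * y ∣ u • (x * y) := by
  obtain _ | n := n
  · simp [eq_zero_of_mem_distFiltration_zero hu]
  have h := smul_mul_sub_mem hu (Ideal.mem_span_singleton_self (x * y)) fun v hv w hw =>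
    Ideal.mem_span_singleton.2 (mul_dvd_mul (hx v (distFiltration_mono n.le_succ hv))
      (hy w (distFiltration_mono n.le_succ hw)))
  rw [Ideal.mem_span_singleton] at h
  rw [← dvd_sub_left (dvd_add (mul_dvd_mul_right (hx u hu) y) (mul_dvd_mul_left x (hy u hu)))]
  exact h

theorem dvd_smul_pow {n : ℕ} {x : A} (hx : ∀ u ∈ distFiltration k R n, x ∣ u • x) (m : ℕ) :
    ∀ u ∈ distFiltration k R n, x ^ m ∣ u • x ^ m := by
  induction m with
  | zero => simp
  | succ m ih =>
    intro u hu
    rw [pow_succ]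
    exact dvd_smul_mul ih hx hu

/-- The power rule for derivations: the lower order corrections are already divisible by the full
power of x. -/
theorem dvd_smul_pow_succ_sub {n : ℕ} {x : A} (hx : ∀ u ∈ distFiltration k R n, x ∣ u • x)
    {u : DistAlg k R} (hu : u ∈ distFiltration k R (n + 1)) (m : ℕ) :
    x ^ (m + 1) ∣ u • x ^ (m + 1) - (m + 1) * x ^ m * u • x := by
  induction m with
  | zero => simp
  | succ m ih =>
    have h := smul_mul_sub_mem hu (Ideal.mem_span_singleton_self (x ^ (m + 1) * x))
      fun v hv w hw => Ideal.mem_span_singleton.2 (mul_dvd_mul (dvd_smul_pow hx (m + 1) v hv)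
        (hx w hw))
    rw [Ideal.mem_span_singleton] at h
    rw [pow_succ x (m + 1)]
    have h2 := dvd_add h (mul_dvd_mul_right ih x)
    convert h2 using 1
    push_cast
    ring

/-- By induction on the order, x divides u(xy) and every lower order term, hence u(x)y, hence u(x)
by coprimality. -/
theorem IsDistStable.left_of_mul [DecompositionMonoid A] {x y : A} (hxy : IsRelPrime x y)
    (h : IsDistStable k R (Ideal.span {x * y})) : IsDistStable k R (Ideal.span {x}) := by
  rw [isDistStable_iff_forall_distFiltration]
  intro n
  induction n with
  | zero =>
    intro u hu
    simp [eq_zero_of_mem_distFiltration_zero hu]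
  | succ n ih =>
    intro u hu
    have h1 := smul_mul_sub_mem hu (Ideal.mem_span_singleton.2 (dvd_mul_right x y))
      fun v hv w hw => Ideal.mem_span_singleton.2 (Dvd.dvd.mul_right (ih v hv) _)
    rw [Ideal.mem_span_singleton, dvd_sub_right
      ((dvd_mul_right x y).trans (isDistStable_span_singleton.1 h u)),
      dvd_add_left (dvd_mul_right _ _)] at h1
    exact hxy.dvd_of_dvd_mul_right h1

variable [IsDomain A]

/-- By induction on the order, a^m divides m a^{m-1} u(a); cancel a^{m-1} and the unit m. -/
theorem IsDistStable.of_pow {a : A} {m : ℕ} (hm : (m : k) ≠ 0)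
    (h : IsDistStable k R (Ideal.span {a ^ m})) : IsDistStable k R (Ideal.span {a}) := by
  obtain rfl | ha := eq_or_ne a 0
  · exact isDistStable_span_singleton.2 fun u => by simp
  obtain _ | m := m
  · simp at hm
  rw [isDistStable_iff_forall_distFiltration]
  intro n
  induction n with
  | zero =>
    intro u hu
    simp [eq_zero_of_mem_distFiltration_zero hu]
  | succ n ih =>
    intro u hu
    have h1 := dvd_smul_pow_succ_sub ih hu m
    rw [dvd_sub_right (isDistStable_span_singleton.1 h u), mul_comm (_ + 1 : A), mul_assoc,
      pow_succ, mul_dvd_mul_iff_left (pow_ne_zero m ha)] at h1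
    have hu : IsUnit ((m : A) + 1) := by
      have := (IsUnit.mk0 _ hm).map (algebraMap k A)
      simpa using this
    exact hu.dvd_mul_left.1 h1

end StableIdeals

/-! ### Irreducibles and unique factorisation in the stable monoid -/

section Factorization

variable {k : Type*} {R : Type*} [Field k] [CommRing R] [Bialgebra k R] [Algebra.FiniteType k R]
  {A : Type*} [CommRing A] [IsDomain A] [Algebra k A] [Module (DistAlg k R) A]
  [IsScalarTower k (DistAlg k R) A] [IsDistAlgebra k R A]

/-- M contains every unit of A, as the unit ideal is stable. -/
theorem isUnit_distStableMonoid_iff {m : distStableMonoid k R A} :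
    IsUnit m ↔ IsUnit (m : A) := by
  refine ⟨fun h => h.map (distStableMonoid k R A).subtype, fun h => ?_⟩
  obtain ⟨v, hv⟩ := h
  refine IsUnit.of_mul_eq_one ⟨(v⁻¹ : Aˣ), v⁻¹.ne_zero, fun u x _ => ?_⟩ ?_
  · rw [Ideal.span_singleton_eq_top.2 v⁻¹.isUnit]
    trivial
  · ext
    simp [← hv]

theorem associated_distStableMonoid_iff {m n : distStableMonoid k R A} :
    Associated m n ↔ Associated (m : A) (n : A) := by
  refine ⟨fun h => h.map (distStableMonoid k R A).subtype, ?_⟩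
  rintro ⟨v, hv⟩
  have hv' : (v : A) ∈ distStableMonoid k R A := by
    refine ⟨v.ne_zero, fun u x _ => ?_⟩
    rw [Ideal.span_singleton_eq_top.2 v.isUnit]
    trivial
  obtain ⟨w, hw⟩ :=
    isUnit_distStableMonoid_iff (k := k) (R := R) (A := A) (m := ⟨(v : A), hv'⟩).2 v.isUnit
  refine ⟨w, ?_⟩
  ext
  rw [hw]
  exact hv

theorem exists_eq_pow_mul_and_cast_ne_zero (q : ℕ) [ExpChar k q] {n : ℕ} (hn : n ≠ 0) :
    ∃ t m : ℕ, n = q ^ t * m ∧ (m : k) ≠ 0 := by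
  cases ‹ExpChar k q› with
  | zero => exact ⟨0, n, by simp, by exact_mod_cast hn⟩
  | prime hq =>
    obtain ⟨t, m, hm, h⟩ := Nat.exists_eq_pow_mul_and_not_dvd hn q hq.ne_one
    exact ⟨t, m, h, fun h0 => hm ((CharP.cast_eq_zero_iff k q m).1 h0)⟩

/-- If `s` is minimal such that `a ^ q ^ s` generates a stable ideal, then the powers of `a` that
generate a stable ideal are those of `a ^ q ^ s`. -/
theorem pow_dvd_of_isDistStable_pow (q : ℕ) [ExpChar k q] {a : A} {s n : ℕ}
    (hs : IsLeast {t : ℕ | IsDistStable k R (Ideal.span {a ^ q ^ t})} s)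
    (h : IsDistStable k R (Ideal.span {a ^ n})) : q ^ s ∣ n := by
  obtain rfl | hn := eq_or_ne n 0
  · exact dvd_zero _
  obtain ⟨t, m, rfl, hm⟩ := exists_eq_pow_mul_and_cast_ne_zero (k := k) q hn
  rw [pow_mul] at h
  exact (pow_dvd_pow q (hs.2 (h.of_pow hm))).mul_right m

theorem expChar_pow_pos (k : Type*) [Field k] (q : ℕ) [ExpChar k q] (s : ℕ) : 0 < q ^ s :=
  pow_pos (expChar_pos k q) s

variable [UniqueFactorizationMonoid A]

/-- A divisor of a^{q^s} is associated to some a^i with i ≤ q^s. If it is stable, then q^s divides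
i, so i is 0 or q^s. -/
theorem IsMinimalStablePower.irreducible {q : ℕ} [ExpChar k q] {m : distStableMonoid k R A}
    (hm : IsMinimalStablePower k R q (m : A)) : Irreducible m := by
  obtain ⟨a, s, ha, hs, h⟩ := hm
  have hq := expChar_pow_pos k q s
  refine ⟨fun hu => ha.not_isUnit ?_, fun x y hxy => ?_⟩
  · rw [isUnit_distStableMonoid_iff, ← h.isUnit_iff, isUnit_pow_iff hq.ne'] at hu
    exact hu
  · have h' : Associated (a ^ q ^ s) ((x : A) * y) := by rwa [hxy] at h
    obtain ⟨i, hi, hxi⟩ := (dvd_prime_pow ha.prime _).1 ((dvd_mul_right (x : A) y).trans h'.dvd')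
    have hdvd := pow_dvd_of_isDistStable_pow q hs (isDistStable_span_of_associated hxi x.2.2)
    obtain rfl | hi0 := Nat.eq_zero_or_pos i
    · left
      rw [isUnit_distStableMonoid_iff, hxi.isUnit_iff, pow_zero]
      exact isUnit_one
    · right
      obtain rfl := le_antisymm hi (Nat.le_of_dvd hi0 hdvd)
      rw [isUnit_distStableMonoid_iff]
      have h2 : Associated ((x : A) * 1) (x * y) := by
        rw [mul_one]
        exact hxi.trans h'
      exact associated_one_iff_isUnit.1 (h2.of_mul_left (.refl _) x.2.1).symm

/-- Stability passes to coprime factors, which reduces to prime powers. -/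
theorem exists_multiset_isMinimalStablePower (q : ℕ) [ExpChar k q] (a : A) (ha : a ≠ 0)
    (h : IsDistStable k R (Ideal.span {a})) :
    ∃ s : Multiset (distStableMonoid k R A),
      (∀ x ∈ s, IsMinimalStablePower k R q (x : A)) ∧ Associated (s.prod : A) a := by
  induction a using UniqueFactorizationMonoid.induction_on_coprime with
  | h0 => exact absurd rfl ha
  | h1 hu => exact ⟨0, by simp, by simpa using (associated_one_iff_isUnit.2 hu).symm⟩
  | hpr i hp =>
    rename_i p
    obtain rfl | hi := eq_or_ne i 0
    · exact ⟨0, by simp, by simp⟩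
    obtain ⟨t, m, rfl, hm⟩ := exists_eq_pow_mul_and_cast_ne_zero (k := k) q hi
    -- Taking the m-th root of the stable power p^{q^t m} gives a stable p^{q^t}, so a minimal
    -- exponent exists.
    have hex : ∃ t, IsDistStable k R (Ideal.span {p ^ q ^ t}) :=
      ⟨t, IsDistStable.of_pow hm (by rwa [← pow_mul])⟩
    classical
    have hs : IsLeast {t : ℕ | IsDistStable k R (Ideal.span {p ^ q ^ t})} (Nat.find hex) :=
      ⟨Nat.find_spec hex, fun t ht => Nat.find_min' hex ht⟩
    obtain ⟨n, hn⟩ := pow_dvd_of_isDistStable_pow q hs h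
    refine ⟨Multiset.replicate n ⟨p ^ q ^ Nat.find hex, pow_ne_zero _ hp.ne_zero, hs.1⟩,
      fun x hx => ?_, ?_⟩
    · rw [Multiset.eq_of_mem_replicate hx]
      exact ⟨p, _, hp.irreducible, hs, .refl _⟩
    · rw [Multiset.prod_replicate, hn, pow_mul]
      exact .refl _
  | hcp hxy hx hy =>
    obtain ⟨s, hs, hs'⟩ := hx (left_ne_zero_of_mul ha) (h.left_of_mul hxy)
    obtain ⟨t, ht, ht'⟩ := hy (right_ne_zero_of_mul ha)
      (IsDistStable.left_of_mul hxy.symm (by rwa [mul_comm]))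
    refine ⟨s + t, fun z hz => (Multiset.mem_add.1 hz).elim (hs z) (ht z), ?_⟩
    rw [Multiset.prod_add]
    exact hs'.mul_mul ht'

theorem irreducible_distStableMonoid_iff (q : ℕ) [ExpChar k q] {m : distStableMonoid k R A} :
    Irreducible m ↔ IsMinimalStablePower k R q (m : A) := by
  refine ⟨fun hm => ?_, fun h => h.irreducible⟩
  obtain ⟨s, hs, h⟩ := exists_multiset_isMinimalStablePower (k := k) (R := R) q m.1 m.2.1 m.2.2
  rw [← associated_distStableMonoid_iff] at h
  have hirr := h.symm.irreducible hm
  obtain rfl | ⟨x, hx⟩ := s.empty_or_exists_mem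
  · exact absurd isUnit_one hirr.not_isUnit
  obtain ⟨t, rfl⟩ := Multiset.exists_cons_of_mem hx
  rw [Multiset.prod_cons] at h hirr
  have hxs := hs x hx
  have hu := (hirr.isUnit_or_isUnit rfl).resolve_left hxs.irreducible.not_isUnit
  have h' := (associated_mul_unit_right x _ hu).trans h
  obtain ⟨a, r, ha, hr, hax⟩ := hxs
  exact ⟨a, r, ha, hr, hax.trans (associated_distStableMonoid_iff.1 h')⟩

/-- This replaces primality of x in A, which may fail. The prime a below x divides some factor y, so
a is associated to the prime below y; associated primes have the same minimal exponent. -/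
theorem IsMinimalStablePower.associated_of_dvd_prod {q : ℕ} [ExpChar k q]
    {x : distStableMonoid k R A} (hx : IsMinimalStablePower k R q (x : A))
    {s : Multiset (distStableMonoid k R A)} (hs : ∀ y ∈ s, IsMinimalStablePower k R q (y : A))
    (h : (x : A) ∣ (s.prod : distStableMonoid k R A)) : ∃ y ∈ s, Associated x y := by
  obtain ⟨a, r, ha, hr, hax⟩ := hx
  have hq := expChar_pow_pos k q r
  have h1 : a ∣ (s.map (distStableMonoid k R A).subtype).prod := by
    rw [← map_multiset_prod]
    exact (dvd_pow_self a hq.ne').trans (hax.dvd.trans h)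
  obtain ⟨y, hy, hay⟩ := ha.prime.exists_mem_multiset_map_dvd h1
  obtain ⟨b, t, hb, ht, hby⟩ := hs y hy
  have hab : Associated a b := ha.associated_of_dvd hb (ha.prime.dvd_of_dvd_pow (hay.trans hby.dvd'))
  have hset : {t : ℕ | IsDistStable k R (Ideal.span {b ^ q ^ t})} =
      {t : ℕ | IsDistStable k R (Ideal.span {a ^ q ^ t})} := by
    ext t
    exact ⟨isDistStable_span_of_associated (hab.symm.pow_pow),
      isDistStable_span_of_associated hab.pow_pow⟩
  rw [hset] at ht
  obtain rfl := hr.unique ht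
  exact ⟨y, hy, associated_distStableMonoid_iff.2 (hax.symm.trans (hab.pow_pow.trans hby))⟩

theorem hasUniqueFactorization_distStableMonoid :
    HasUniqueFactorization (distStableMonoid k R A) := by
  obtain ⟨q, hq⟩ := ExpChar.exists k
  refine ⟨fun m => ?_, fun s => ?_⟩
  · obtain ⟨s, hs, h⟩ := exists_multiset_isMinimalStablePower (k := k) (R := R) q m.1 m.2.1 m.2.2
    exact ⟨s, fun x hx => (hs x hx).irreducible, associated_distStableMonoid_iff.2 h⟩
  induction s using Multiset.induction_on with
  | empty =>
    intro t _ ht h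
    obtain rfl | ⟨x, hx⟩ := t.empty_or_exists_mem
    · exact .zero
    · have hu : IsUnit t.prod := h.isUnit isUnit_one
      exact absurd (isUnit_of_dvd_unit (Multiset.dvd_prod hx) hu) (ht x hx).not_isUnit
  | cons x s ih =>
    intro t hs ht h
    rw [Multiset.forall_mem_cons] at hs
    have hdvd : (x : A) ∣ (t.prod : distStableMonoid k R A) := by
      refine (Dvd.intro (s.prod : A) ?_).trans (associated_distStableMonoid_iff.1 h).dvd
      rw [Multiset.prod_cons]
      rfl
    obtain ⟨y, hy, hxy⟩ := ((irreducible_distStableMonoid_iff q).1 hs.1).associated_of_dvd_prod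
      (fun y hy => (irreducible_distStableMonoid_iff q).1 (ht y hy)) hdvd
    obtain ⟨t, rfl⟩ := Multiset.exists_cons_of_mem hy
    rw [Multiset.forall_mem_cons] at ht
    rw [Multiset.prod_cons, Multiset.prod_cons] at h
    refine .cons hxy (ih t hs.2 ht.2 ?_)
    rw [associated_distStableMonoid_iff] at h hxy ⊢
    exact Associated.of_mul_left h hxy x.2.1

theorem image_irreducible_distStableMonoid (q : ℕ) [ExpChar k q] :
    Subtype.val '' {m : distStableMonoid k R A | Irreducible m} =
      {b : A | IsMinimalStablePower k R q b} := by
  ext b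
  constructor
  · rintro ⟨m, hm, rfl⟩
    exact (irreducible_distStableMonoid_iff q).1 hm
  · intro hb
    obtain ⟨a, s, ha, hs, h⟩ := id hb
    have hbm : b ∈ distStableMonoid k R A :=
      ⟨h.ne_zero_iff.1 (pow_ne_zero _ ha.ne_zero), isDistStable_span_of_associated h hs.1⟩
    exact ⟨⟨b, hbm⟩, (irreducible_distStableMonoid_iff q).2 hb, rfl⟩

end Factorization

end GroupSchemeDist

theorem mainTheorem1 {k : Type u} [Field k]
    (H : Scheme.{u}) [H.Over (Spec (.of k))] [GrpObj (H.asOver (Spec (.of k)))]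
    [IsAffine H] [LocallyOfFiniteType (H ↘ Spec (.of k))] [IrreducibleSpace H]
    (A : Type v) [CommRing A] [IsDomain A] [UniqueFactorizationMonoid A] [Algebra k A]
    [Module (DistAlg k (CoordRing H)) A] [IsScalarTower k (DistAlg k (CoordRing H)) A]
    [IsDistAlgebra k (CoordRing H) A] :
    HasUniqueFactorization (distStableMonoid k (CoordRing H) A) ∧
    (CharZero k →
      Subtype.val '' {m : distStableMonoid k (CoordRing H) A | Irreducible m} =
        {a : A | Irreducible a ∧ IsLieStable k (CoordRing H) (Ideal.span {a})}) ∧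
    (∀ p : ℕ, p.Prime → CharP k p →
      Subtype.val '' {m : distStableMonoid k (CoordRing H) A | Irreducible m} =
        {b : A | ∃ (a : A) (s : ℕ), Irreducible a ∧
          IsLeast {t : ℕ | IsDistStable k (CoordRing H) (Ideal.span {a ^ p ^ t})} s ∧
          Associated (a ^ p ^ s) b}) := by
  refine ⟨hasUniqueFactorization_distStableMonoid, fun _ => ?_, fun p hp _ => ?_⟩
  -- The exponential characteristic is 1 here.
  · rw [image_irreducible_distStableMonoid 1]
    ext a
    rw [Set.mem_ofPred_eq, isMinimalStablePower_one_iff, isDistStable_iff_isLieStable]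
    rfl
  · have : ExpChar k p := .prime hp
    exact image_irreducible_distStableMonoid p
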